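/- Fix an integer $r\ge 2$ and sequences $p_n\in(0,1)$, $\rho_n\in[0,p_n(1-p_n))$ and positive integers $c_n$. For each $n$ let $(H_n^{(1)},H_n^{(2)})$ be a correlated Erdős–Rényi $r$-uniform random 2-hypermultiplex $\boldsymbol H_r(n,p_n,\rho_n)$: both $H_n^{(1)}$ and $H_n^{(2)}$ are $r$-uniform hypergraphs on the vertex set $[n]=\{1,\dots,n\}$ and, independently for every $r$-element subset $e\subseteq[n]$, $$\mathbb P(e\in E(H_n^{(1)}))=\mathbb P(e\in E(H_n^{(2)}))=p_n,\qquad \mathbb P(e\in E(H_n^{(1)})\cap E(H_n^{(2)}))=\rho_n+p_n^2 .$$ Independently of $(H_n^{(1)},H_n^{(2)})$, color the vertices independently and uniformly at random with $c_n$ colors, and let $T(H_n^{(i)})$ be the number of monochromatic hyperedges of $H_n^{(i)}$, i.e. hyperedges all of whose vertices have the same color. Assume that $p_n\gg n^{-r}$, i.e. $n^r p_n\to\infty$, and that, as $n\to\infty$, $$\frac{\binom nr p_n}{c_n^{r-1}}\to\lambda\qquad\text{and}\qquad \frac{\binom nr(\rho_n+p_n^2)}{c_n^{r-1}}\to\lambda_{1,2}$$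 for constants $0\le\lambda_{1,2}<\lambda$. Then, as $n\to\infty$, $$\bigl(T(H_n^{(1)}),\,T(H_n^{(2)})\bigr)\ \xrightarrow{\ d\ }\ (Z_1+Z_{1,2},\;Z_2+Z_{1,2}),$$ where $Z_1\sim\mathrm{Pois}(\lambda-\lambda_{1,2})$, $Z_2\sim\mathrm{Pois}(\lambda-\lambda_{1,2})$ and $Z_{1,2}\sim\mathrm{Pois}(\lambda_{1,2})$ are independent. -/

import Mathlib

open MeasureTheory ProbabilityTheory Filter Topology
open scoped NNReal

/-- An `r`-uniform hypergraph whose vertex set is the whole type `V`: a finite set of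
`r`-element subsets of `V` (without repetition). Two such hypergraphs on the same `V` form
a 2-hypermultiplex, i.e. an element of `UniformHypergraph V r × UniformHypergraph V r`. -/
@[ext]
structure UniformHypergraph (V : Type*) (r : ℕ) where
  /-- the set of hyperedges -/
  edges : Finset (Finset V)
  /-- every hyperedge has exactly `r` vertices -/
  card_eq : ∀ e ∈ edges, e.card = r

/-- Hypergraphs carry the discrete σ-algebra (for finite `V` there are finitely many of them). -/
instance UniformHypergraph.instMeasurableSpace (V : Type*) (r : ℕ) :
    MeasurableSpace (UniformHypergraph V r) := ⊤

/-- A set of vertices is monochromatic under the coloring `x` if all of its vertices have the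
same color. -/
def IsMonochromatic {V C : Type*} (x : V → C) (e : Finset V) : Prop :=
  ∀ v ∈ e, ∀ v' ∈ e, x v = x v'

open scoped Classical in
/-- `T(H)` for the coloring `x`: the number of monochromatic hyperedges of `H`. -/
noncomputable def monoCount {V C : Type*} {r : ℕ} (H : UniformHypergraph V r) (x : V → C) : ℕ :=
  (H.edges.filter (IsMonochromatic x)).card

/-- The random 2-hypermultiplex `H = (H⁽¹⁾, H⁽²⁾)`, defined on the probability space `(Ω, P)`,
is a correlated Erdős–Rényi `r`-uniform random hypermultiplex `H_r(n, p, ρ)` on `n` vertices: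
independently for every `r`-element set `e` of vertices, `e` is a hyperedge of `H⁽¹⁾` with
probability `p`, of `H⁽²⁾` with probability `p`, and of both with probability `ρ + p ^ 2`. -/
structure IsCorrelatedErdosRenyi {Ω : Type*} [MeasurableSpace Ω] (P : Measure Ω) {n r : ℕ}
    (H : Ω → UniformHypergraph (Fin n) r × UniformHypergraph (Fin n) r) (p ρ : ℝ) : Prop where
  measurable : Measurable H
  prob_fst : ∀ e : Finset (Fin n), e.card = r → P.real {ω | e ∈ (H ω).1.edges} = p
  prob_snd : ∀ e : Finset (Fin n), e.card = r → P.real {ω | e ∈ (H ω).2.edges} = p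
  prob_both : ∀ e : Finset (Fin n), e.card = r →
    P.real {ω | e ∈ (H ω).1.edges ∧ e ∈ (H ω).2.edges} = ρ + p ^ 2
  indep : iIndepFun (fun (e : {e : Finset (Fin n) // e.card = r}) ω ↦
    ((e.1 ∈ (H ω).1.edges, e.1 ∈ (H ω).2.edges) : Prop × Prop)) P

/-- The random coloring `X` of the vertices `V` with `c` colors is uniform: each vertex has each
color with probability `1 / c`, independently of the other vertices. -/
structure IsUniformColoring {Ω : Type*} [MeasurableSpace Ω] (P : Measure Ω) {V : Type*} {c : ℕ}
    (X : Ω → V → Fin c) : Prop where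
  measurable : Measurable X
  prob : ∀ (v : V) (a : Fin c), P.real {ω | X ω v = a} = 1 / (c : ℝ)
  indep : iIndepFun (fun (v : V) ω ↦ X ω v) P

/-! Fix `z = exp (i s)`, `w = exp (i t)`. Given the coloring, every monochromatic `r`-set
contributes to the joint characteristic function an independent factor of mean `1 + η`, where `η = p
(z - 1) + p (w - 1) + (ρ + p ^ 2) (z - 1) (w - 1)`. Hence the characteristic function equals `E (1 +
η) ^ M`, with `M` the number of monochromatic `r`-sets among all `r`-sets
(`integral_pow_monoCount`). The two-dimensional problem becomes a Poisson approximation for the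
single count `M`.

Monochromaticity of disjoint sets is independent, so `M` counts dissociated events. The function `g
u = E (1 + u η) ^ M` then nearly solves `g' = η E[M] g`, which gives `g 1 ≈ exp (η E[M])` with an
error controlled by overlapping pairs (`norm_integral_one_add_pow_occurrences_sub_exp_le`).

The error carries `‖η‖ ^ 2 ≤ 64 p ^ 2`. One factor `p` makes `n.choose r * p / c ^ (r - 1)`, which
converges; the other goes to the overlap terms `p (n / c) ^ j` with `1 ≤ j < r`, which vanish
(`tendsto_mul_div_pow_zero`). Finally `η E[M]` converges to the exponent of the bivariate Poisson
characteristic function, and Lévy's theorem concludes. -/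

/-! ### Convergence in distribution on `ℕ × ℕ` via characteristic functions -/

/-- Convergence in distribution can be tested after a closed embedding into a normal space. -/
theorem tendstoInDistribution_of_isClosedEmbedding_comp {ι E F Ω' : Type*} {Ω : ι → Type*}
    [∀ i, MeasurableSpace (Ω i)] [MeasurableSpace Ω']
    [TopologicalSpace E] [MeasurableSpace E] [BorelSpace E]
    [TopologicalSpace F] [NormalSpace F] [MeasurableSpace F] [BorelSpace F]
    {P : ∀ i, Measure (Ω i)} [∀ i, IsProbabilityMeasure (P i)]
    {P' : Measure Ω'} [IsProbabilityMeasure P']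
    {X : ∀ i, Ω i → E} {Z : Ω' → E} {l : Filter ι} {f : E → F} (hf : IsClosedEmbedding f)
    (hX : ∀ i, AEMeasurable (X i) (P i)) (hZ : AEMeasurable Z P')
    (h : TendstoInDistribution (fun i ↦ f ∘ X i) l (f ∘ Z) P P') :
    TendstoInDistribution X l Z P P' where
  forall_aemeasurable := hX
  aemeasurable_limit := hZ
  tendsto := by
    have key := ProbabilityMeasure.tendsto_iff_forall_integral_tendsto.1 h.tendsto
    refine ProbabilityMeasure.tendsto_iff_forall_integral_tendsto.2 fun φ ↦ ?_
    -- Tietze extension: the test function `φ` on `E` is `g ∘ f` for a bounded continuous `g` on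
    -- `F`.
    obtain ⟨g, -, hg⟩ := φ.exists_extension_norm_eq_of_isClosedEmbedding hf
    have hfm : Measurable f := hf.continuous.measurable
    have hgf : Continuous (g ∘ f) := g.continuous.comp hf.continuous
    have := key g
    simp only [ProbabilityMeasure.coe_mk] at this ⊢
    rw [integral_map (hfm.comp_aemeasurable hZ)
      g.continuous.measurable.aestronglyMeasurable] at this
    rw [← hg, integral_map hZ hgf.measurable.aestronglyMeasurable]
    refine this.congr fun i ↦ ?_
    rw [integral_map (hfm.comp_aemeasurable (hX i)) g.continuous.measurable.aestronglyMeasurable,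
      integral_map (hX i) hgf.measurable.aestronglyMeasurable]
    rfl

/-- The inclusion of pairs of natural numbers into the Euclidean plane. -/
noncomputable def natPairToPlane (a : ℕ × ℕ) : WithLp 2 (ℝ × ℝ) :=
  WithLp.toLp 2 ((a.1 : ℝ), (a.2 : ℝ))

theorem isClosedEmbedding_natPairToPlane : IsClosedEmbedding natPairToPlane :=
  (WithLp.homeomorphProd 2 ℝ ℝ).symm.isClosedEmbedding.comp
    (Nat.isClosedEmbedding_coe_real.prodMap Nat.isClosedEmbedding_coe_real)

theorem charFun_map_natPairToPlane {Ω : Type*} [MeasurableSpace Ω] {P : Measure Ω}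
    {X : Ω → ℕ × ℕ} (hX : AEMeasurable X P) (w : WithLp 2 (ℝ × ℝ)) :
    charFun (P.map (natPairToPlane ∘ X)) w =
      ∫ ω, Complex.exp (((w.fst * (X ω).1 + w.snd * (X ω).2 : ℝ) : ℂ) * Complex.I) ∂P := by
  have hm : Measurable natPairToPlane := isClosedEmbedding_natPairToPlane.continuous.measurable
  rw [charFun_apply]
  refine (integral_map (hm.comp_aemeasurable hX) (by fun_prop)).trans ?_
  congr! 4

/-- Lévy's continuity theorem for pairs of natural numbers. -/
theorem tendstoInDistribution_natPair {Ω' : Type*} {Ω : ℕ → Type*}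
    [∀ i, MeasurableSpace (Ω i)] [MeasurableSpace Ω']
    {P : ∀ i, Measure (Ω i)} [∀ i, IsProbabilityMeasure (P i)]
    {P' : Measure Ω'} [IsProbabilityMeasure P']
    {X : ∀ i, Ω i → ℕ × ℕ} {Z : Ω' → ℕ × ℕ}
    (hX : ∀ i, AEMeasurable (X i) (P i)) (hZ : AEMeasurable Z P')
    (h : ∀ s t : ℝ, Tendsto
      (fun i ↦ ∫ ω, Complex.exp (((s * (X i ω).1 + t * (X i ω).2 : ℝ) : ℂ) * Complex.I) ∂(P i))
      atTop (𝓝 (∫ ω, Complex.exp (((s * (Z ω).1 + t * (Z ω).2 : ℝ) : ℂ) * Complex.I) ∂P'))) :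
    TendstoInDistribution X atTop Z P P' := by
  have hm : Measurable natPairToPlane := isClosedEmbedding_natPairToPlane.continuous.measurable
  refine tendstoInDistribution_of_isClosedEmbedding_comp isClosedEmbedding_natPairToPlane hX hZ
    ⟨fun i ↦ hm.comp_aemeasurable (hX i), hm.comp_aemeasurable hZ, 
      ProbabilityMeasure.tendsto_iff_tendsto_charFun.2 fun w ↦ ?_⟩
  simp only [ProbabilityMeasure.coe_mk]
  rw [charFun_map_natPairToPlane hZ]
  simp_rw [charFun_map_natPairToPlane (hX _)]
  exact h w.fst w.snd

/-! ### Characteristic functions of the Poisson limits -/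

theorem integral_exp_of_hasLaw_poissonMeasure {Ω : Type*} [MeasurableSpace Ω] {P : Measure Ω}
    {Z : Ω → ℕ} {a : ℝ≥0} (hZ : HasLaw Z (poissonMeasure a) P) (t : ℝ) :
    ∫ ω, Complex.exp (((t * Z ω : ℝ) : ℂ) * Complex.I) ∂P =
      Complex.exp (a * (Complex.exp (t * Complex.I) - 1)) := by
  rw [← charFun_map_cast_poissonMeasure, charFun_apply, integral_map (by fun_prop) (by fun_prop),
    ← hZ.map_eq, integral_map hZ.aemeasurable Measurable.of_discrete.aestronglyMeasurable]
  congr! 4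

/-- The characteristic function of the bivariate Poisson distribution. -/
theorem integral_exp_bivariate_poisson {Ω : Type*} [MeasurableSpace Ω] {P : Measure Ω}
    {Z1 Z2 Z12 : Ω → ℕ} {a b d : ℝ≥0}
    (hZ1 : HasLaw Z1 (poissonMeasure a) P) (hZ2 : HasLaw Z2 (poissonMeasure b) P)
    (hZ12 : HasLaw Z12 (poissonMeasure d) P) (hZ : iIndepFun ![Z1, Z2, Z12] P) (s t : ℝ) :
    ∫ ω, Complex.exp (((s * (Z1 ω + Z12 ω : ℕ) + t * (Z2 ω + Z12 ω : ℕ) : ℝ) : ℂ)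
      * Complex.I) ∂P =
    Complex.exp (a * (Complex.exp (s * Complex.I) - 1) + b * (Complex.exp (t * Complex.I) - 1)
      + d * (Complex.exp ((s + t : ℝ) * Complex.I) - 1)) := by
  -- The shared variable `Z12` enters both coordinates, hence its frequency `s + t`.
  have h := hZ.integral_fun_prod_comp
    (f := fun i (k : ℕ) ↦ Complex.exp (((![s, t, s + t] i * k : ℝ) : ℂ) * Complex.I))
    (fun i ↦ by
      fin_cases i
      exacts [hZ1.aemeasurable, hZ2.aemeasurable, hZ12.aemeasurable])
    (fun i ↦ Measurable.of_discrete.aestronglyMeasurable)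
  simp only [Fin.prod_univ_three] at h
  simp only [Matrix.cons_val_zero, Matrix.cons_val_one, Matrix.cons_val] at h
  rw [integral_exp_of_hasLaw_poissonMeasure hZ1, integral_exp_of_hasLaw_poissonMeasure hZ2,
    integral_exp_of_hasLaw_poissonMeasure hZ12] at h
  rw [Complex.exp_add, Complex.exp_add, ← h]
  congr! 2 with ω
  rw [← Complex.exp_add, ← Complex.exp_add]
  congr 1
  push_cast
  ring

/-! ### Two analytic estimates -/

theorem norm_pow_add_sub_pow_le {z : ℂ} (hz : ‖z‖ ≤ 1) (a b : ℕ) :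
    ‖z ^ (a + b) - z ^ b‖ ≤ a * ‖z - 1‖ := by
  have h : ‖z ^ a - 1‖ ≤ a * ‖z - 1‖ := by
    rw [← geom_sum_mul, norm_mul]
    gcongr
    refine (norm_sum_le _ _).trans ?_
    calc ∑ i ∈ Finset.range a, ‖z ^ i‖ ≤ ∑ i ∈ Finset.range a, (1 : ℝ) := by
          gcongr with i
          rw [norm_pow]
          exact pow_le_one₀ (norm_nonneg _) hz
      _ = a := by simp
  calc ‖z ^ (a + b) - z ^ b‖ = ‖z ^ a - 1‖ * ‖z ^ b‖ := by
        rw [← norm_mul]; congr 1; ring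
    _ ≤ (a * ‖z - 1‖) * 1 := by
        gcongr
        rw [norm_pow]
        exact pow_le_one₀ (norm_nonneg _) hz
    _ = _ := mul_one _

/-- A function that almost satisfies `g' = m g` on `[0, 1]` and starts from `1` ends near
`exp m`. -/
theorem norm_sub_exp_le_of_deriv_close {g g' : ℝ → ℂ} {m : ℂ} {ε : ℝ}
    (hg : ∀ u ∈ Set.Icc (0 : ℝ) 1, HasDerivAt g (g' u) u) (h0 : g 0 = 1)
    (hε : ∀ u ∈ Set.Icc (0 : ℝ) 1, ‖g' u - m * g u‖ ≤ ε) :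
    ‖g 1 - Complex.exp m‖ ≤ Real.exp (2 * ‖m‖) * ε := by
  have hε0 : 0 ≤ ε := (norm_nonneg _).trans (hε 0 (by simp))
  have hexp (u : ℝ) (hu : u ∈ Set.Icc (0 : ℝ) 1) :
      ‖Complex.exp (-(u * m))‖ ≤ Real.exp ‖m‖ := by
    refine (Complex.norm_exp_le_exp_norm _).trans (Real.exp_le_exp.2 ?_)
    rw [norm_neg, norm_mul, Complex.norm_real, Real.norm_of_nonneg hu.1]
    exact mul_le_of_le_one_left (norm_nonneg _) hu.2
  -- Integrating factor: the derivative of `g u * exp (-u m)` is the defect times `exp (-u m)`. One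
  -- `exp ‖m‖` comes from this factor, another from multiplying back by `exp m`.
  have hd (u : ℝ) (hu : u ∈ Set.Icc (0 : ℝ) 1) :
      HasDerivAt (fun u : ℝ ↦ g u * Complex.exp (-(u * m)))
        ((g' u - m * g u) * Complex.exp (-(u * m))) u := by
    have h1 : HasDerivAt (fun u : ℝ ↦ Complex.exp (-((u : ℂ) * m)))
        (Complex.exp (-(u * m)) * -m) u := by
      have : HasDerivAt (fun u : ℝ ↦ -((u : ℂ) * m)) (-(1 * m)) u :=
        (((hasDerivAt_id u).ofReal_comp).mul_const m).neg
      simpa using this.cexp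
    refine ((hg u hu).fun_mul h1).congr_deriv ?_
    ring
  have key := norm_image_sub_le_of_norm_deriv_le_segment_01' (C := ε * Real.exp ‖m‖)
    (fun u hu ↦ (hd u hu).hasDerivWithinAt)
    (fun u hu ↦ by
      have hu' := Set.Ico_subset_Icc_self hu
      rw [norm_mul]
      exact mul_le_mul (hε u hu') (hexp u hu') (norm_nonneg _) hε0)
  simp only [Complex.ofReal_one, one_mul, h0, Complex.ofReal_zero, zero_mul, neg_zero,
    Complex.exp_zero, mul_one] at key
  calc ‖g 1 - Complex.exp m‖ = ‖(g 1 * Complex.exp (-m) - 1) * Complex.exp m‖ := by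
        congr 1
        rw [sub_mul, mul_assoc, ← Complex.exp_add]
        simp
    _ ≤ (ε * Real.exp ‖m‖) * Real.exp ‖m‖ := by
        rw [norm_mul]
        exact mul_le_mul key (Complex.norm_exp_le_exp_norm _) (norm_nonneg _) (by positivity)
    _ = _ := by rw [two_mul, Real.exp_add]; ring

/-! ### Poisson approximation for dissociated events -/

/-- The number of sets `A e`, `e ∈ s`, that contain `ω`. -/
noncomputable def occurrences {Ω ι : Type*} (A : ι → Set Ω) (s : Finset ι) (ω : Ω) : ℕ :=
  ∑ e ∈ s, (A e).indicator 1 ω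

theorem occurrences_add {Ω ι : Type*} {A : ι → Set Ω} [DecidableEq ι] {s t : Finset ι} (h : t ⊆ s) (ω : Ω) :
    occurrences A s ω = occurrences A t ω + occurrences A (s \ t) ω := by
  rw [add_comm]
  exact (Finset.sum_sdiff h).symm

theorem occurrences_insert_erase {Ω ι : Type*} {A : ι → Set Ω} [DecidableEq ι] {t : Finset ι} {e : ι}
    (he : e ∈ t) {ω : Ω} (hω : ω ∈ A e) :
    occurrences A t ω = 1 + occurrences A (t.erase e) ω := by
  rw [occurrences, ← Finset.add_sum_erase _ _ he, Set.indicator_of_mem hω]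
  rfl

section Dissociated

variable {Ω ι : Type*} [MeasurableSpace Ω] {P : Measure Ω} [IsProbabilityMeasure P]

theorem hasDerivAt_integral_one_add_mul_pow {M : Ω → ℕ} (hM : Measurable M) {N : ℕ}
    (hN : ∀ ω, M ω ≤ N) (η : ℂ) (u : ℝ) :
    HasDerivAt (fun u : ℝ ↦ ∫ ω, (1 + u * η) ^ M ω ∂P)
      (∫ ω, M ω * (1 + u * η) ^ (M ω - 1) * η ∂P) u := by
  have hm : ∀ f : ℕ → ℂ, AEStronglyMeasurable (fun ω ↦ f (M ω)) P := fun f ↦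
    (Measurable.of_discrete.comp hM : Measurable (f ∘ M)).aestronglyMeasurable
  have hb (x : ℝ) (hx : x ∈ Metric.ball u 1) : ‖(1 + x * η : ℂ)‖ ≤ 1 + (|u| + 1) * ‖η‖ := by
    refine (norm_add_le _ _).trans ?_
    rw [norm_one, norm_mul, Complex.norm_real, Real.norm_eq_abs]
    gcongr
    have := abs_sub_abs_le_abs_sub x u
    rw [Metric.mem_ball, Real.dist_eq] at hx
    linarith
  have hB : 1 ≤ 1 + (|u| + 1) * ‖η‖ := le_add_of_nonneg_right (by positivity)
  refine (hasDerivAt_integral_of_dominated_loc_of_deriv_le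
    (F := fun (u : ℝ) ω ↦ (1 + u * η) ^ M ω)
    (F' := fun (u : ℝ) ω ↦ M ω * (1 + u * η) ^ (M ω - 1) * η)
    (bound := fun _ ↦ N * (1 + (|u| + 1) * ‖η‖) ^ N * ‖η‖)
    (Metric.ball_mem_nhds u one_pos) (.of_forall fun x ↦ hm fun k ↦ (1 + x * η) ^ k) ?_
    (hm fun k ↦ k * (1 + u * η) ^ (k - 1) * η) ?_ (integrable_const _) ?_).2
  · refine .of_bound (hm fun k ↦ (1 + u * η) ^ k) ((1 + (|u| + 1) * ‖η‖) ^ N)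
      (.of_forall fun ω ↦ ?_)
    rw [norm_pow]
    exact (pow_le_pow_left₀ (norm_nonneg _) (hb u (by simp)) _).trans
      (pow_le_pow_right₀ hB (hN ω))
  · refine .of_forall fun ω x hx ↦ ?_
    rw [norm_mul, norm_mul, norm_pow, Complex.norm_natCast]
    gcongr
    · exact hN ω
    · exact (pow_le_pow_left₀ (norm_nonneg _) (hb x hx) _).trans
        (pow_le_pow_right₀ hB ((Nat.sub_le _ _).trans (hN ω)))
  · refine .of_forall fun ω x hx ↦ ?_
    have : HasDerivAt (fun u : ℝ ↦ (1 + u * η : ℂ)) (1 * η) x :=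
      (((hasDerivAt_id x).ofReal_comp).mul_const η).const_add 1
    simpa using this.fun_pow (M ω)

/-- The point is a convex combination of `1` and `1 + η`, and the unit disc is convex. -/
theorem norm_one_add_mul_le {η : ℂ} (hη : ‖1 + η‖ ≤ 1) {u : ℝ} (hu : u ∈ Set.Icc (0 : ℝ) 1) :
    ‖1 + u * η‖ ≤ 1 := by
  calc ‖1 + u * η‖ = ‖((1 - u : ℝ) : ℂ) + u * (1 + η)‖ := by congr 1; push_cast; ring
    _ ≤ (1 - u) + u * ‖1 + η‖ := by
        refine (norm_add_le _ _).trans ?_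
        rw [norm_mul, Complex.norm_real, Complex.norm_real, Real.norm_of_nonneg hu.1,
          Real.norm_of_nonneg (by linarith [hu.2])]
    _ ≤ (1 - u) + u * 1 := by gcongr; exact hu.1
    _ = 1 := by ring

theorem measurable_occurrences {A : ι → Set Ω} (hA : ∀ e, MeasurableSet (A e)) (s : Finset ι) :
    Measurable (occurrences A s) :=
  Finset.measurable_fun_sum _ fun e _ ↦ measurable_one.indicator (hA e)

theorem integral_occurrences {A : ι → Set Ω} (hA : ∀ e, MeasurableSet (A e)) (s : Finset ι) :
    ∫ ω, (occurrences A s ω : ℝ) ∂P = ∑ e ∈ s, P.real (A e) := by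
  have h (e : ι) (ω : Ω) : (((A e).indicator 1 ω : ℕ) : ℝ) = (A e).indicator 1 ω := by
    by_cases h : ω ∈ A e <;> simp [h]
  simp only [occurrences, Nat.cast_sum, h]
  rw [integral_finsetSum (f := fun e ↦ (A e).indicator (1 : Ω → ℝ)) _
    fun e _ ↦ (integrable_const (1 : ℝ)).indicator (hA e)]
  simp_rw [integral_indicator_one (hA _)]

theorem integrable_comp_occurrences {A : ι → Set Ω} (hA : ∀ e, MeasurableSet (A e))
    (s : Finset ι) {E : Type*} [NormedAddCommGroup E] (f : ℕ → E) :
    Integrable (fun ω ↦ f (occurrences A s ω)) P := by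
  have hle (ω : Ω) : occurrences A s ω ≤ s.card := by
    rw [Finset.card_eq_sum_ones]
    exact Finset.sum_le_sum fun e _ ↦ Set.indicator_le_self' (by simp) ω
  refine .of_bound (C := ∑ k ∈ Finset.range (s.card + 1), ‖f k‖)
    (StronglyMeasurable.of_discrete.comp_measurable
      (measurable_occurrences hA s)).aestronglyMeasurable (.of_forall fun ω ↦ ?_)
  exact Finset.single_le_sum (f := fun k ↦ ‖f k‖) (fun _ _ ↦ norm_nonneg _)
    (Finset.mem_range.2 (Nat.lt_succ_of_le (hle ω)))

theorem setIntegral_occurrences {A : ι → Set Ω} (hA : ∀ e, MeasurableSet (A e)) (s : Finset ι)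
    (e : ι) : ∫ ω in A e, (occurrences A s ω : ℝ) ∂P = ∑ e' ∈ s, P.real (A e ∩ A e') := by
  have h (e : ι) (ω : Ω) : (((A e).indicator 1 ω : ℕ) : ℝ) = (A e).indicator 1 ω := by
    by_cases h : ω ∈ A e <;> simp [h]
  simp only [occurrences, Nat.cast_sum, h]
  rw [integral_finsetSum (f := fun e ↦ (A e).indicator (1 : Ω → ℝ)) _
    fun e _ ↦ (integrable_const (1 : ℝ)).indicator (hA e)]
  simp_rw [integral_indicator_one (hA _), measureReal_restrict_apply (hA _), Set.inter_comm]

theorem norm_integral_pow_occurrences_sub_le {A : ι → Set Ω} (hA : ∀ e, MeasurableSet (A e))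
    [DecidableEq ι] {s t : Finset ι} (h : t ⊆ s) {z : ℂ} (hz : ‖z‖ ≤ 1) :
    ‖∫ ω, z ^ occurrences A (s \ t) ω ∂P - ∫ ω, z ^ occurrences A s ω ∂P‖ ≤
      ‖z - 1‖ * ∑ e ∈ t, P.real (A e) := by
  rw [← integral_sub (integrable_comp_occurrences hA _ (z ^ ·))
    (integrable_comp_occurrences hA _ (z ^ ·)), ← integral_occurrences hA, ← integral_const_mul]
  refine norm_integral_le_of_norm_le
    ((integrable_comp_occurrences hA t (fun k ↦ (k : ℝ))).const_mul _) (.of_forall fun ω ↦ ?_)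
  rw [occurrences_add h, norm_sub_rev, mul_comm]
  exact norm_pow_add_sub_pow_le hz _ _

/-- On `A e` the event `e` itself is counted, so the subtraction of `1` is not truncated and leaves
the other events. Only those of `t.erase e` separate the two exponents. -/
theorem norm_setIntegral_pow_occurrences_sub_le {A : ι → Set Ω}
    (hA : ∀ e, MeasurableSet (A e)) [DecidableEq ι] {s t : Finset ι} (h : t ⊆ s) {e : ι}
    (he : e ∈ t) {z : ℂ} (hz : ‖z‖ ≤ 1) :
    ‖∫ ω in A e, z ^ (occurrences A s ω - 1) ∂P - ∫ ω in A e, z ^ occurrences A (s \ t) ω ∂P‖ ≤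
      ‖z - 1‖ * ∑ e' ∈ t.erase e, P.real (A e ∩ A e') := by
  rw [← integral_sub (integrable_comp_occurrences hA _ (fun k ↦ z ^ (k - 1))).integrableOn
    (integrable_comp_occurrences hA _ (z ^ ·)).integrableOn, ← setIntegral_occurrences hA,
    ← integral_const_mul]
  refine norm_integral_le_of_norm_le
    ((integrable_comp_occurrences hA _ (fun k ↦ (k : ℝ))).const_mul _).integrableOn ?_
  filter_upwards [ae_restrict_mem (hA e)] with ω hω
  rw [occurrences_add h, occurrences_insert_erase he hω, mul_comm, add_assoc,
    Nat.add_sub_cancel_left]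
  exact norm_pow_add_sub_pow_le hz _ _

/-- Poisson approximation of the number of occurrences of dissociated events: `B e` is the
neighbourhood of dependence of `e`. -/
theorem norm_integral_one_add_pow_occurrences_sub_exp_le {A : ι → Set Ω}
    (hA : ∀ e, MeasurableSet (A e)) [DecidableEq ι] {s : Finset ι} {B : ι → Finset ι}
    (hB : ∀ e ∈ s, B e ⊆ s) (hmem : ∀ e ∈ s, e ∈ B e)
    (hind : ∀ e ∈ s, IndepFun ((A e).indicator (1 : Ω → ℂ)) (occurrences A (s \ B e)) P)
    {η : ℂ} (hη : ‖1 + η‖ ≤ 1) :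
    ‖∫ ω, (1 + η) ^ occurrences A s ω ∂P - Complex.exp (η * ∑ e ∈ s, P.real (A e))‖ ≤
      Real.exp (2 * ‖η * ∑ e ∈ s, P.real (A e)‖) *
        (‖η‖ ^ 2 * ∑ e ∈ s, (∑ e' ∈ (B e).erase e, P.real (A e ∩ A e') +
          P.real (A e) * ∑ e' ∈ B e, P.real (A e'))) := by
  set M := occurrences A s with hMdef
  have hle (ω : Ω) : M ω ≤ s.card := by
    rw [Finset.card_eq_sum_ones]
    exact Finset.sum_le_sum fun e _ ↦ Set.indicator_le_self' (by simp) ω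
  have key := norm_sub_exp_le_of_deriv_close (m := η * ∑ e ∈ s, P.real (A e))
    (ε := ‖η‖ ^ 2 * ∑ e ∈ s, (∑ e' ∈ (B e).erase e, P.real (A e ∩ A e') +
          P.real (A e) * ∑ e' ∈ B e, P.real (A e')))
    (fun u _ ↦ hasDerivAt_integral_one_add_mul_pow (P := P) (measurable_occurrences hA s) hle η u)
    (by simp) (fun u hu ↦ ?_)
  · simpa using key
  set z : ℂ := 1 + u * η with hzdef
  have hz : ‖z‖ ≤ 1 := norm_one_add_mul_le hη hu
  have hz1 : ‖z - 1‖ ≤ ‖η‖ := by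
    rw [hzdef, add_sub_cancel_left, norm_mul, Complex.norm_real, Real.norm_of_nonneg hu.1]
    exact mul_le_of_le_one_left (norm_nonneg _) hu.2
  -- Writing the factor `M` as a sum of indicators localizes the derivative on each `A e`.
  have hderiv : ∫ ω, M ω * z ^ (M ω - 1) * η ∂P =
      η * ∑ e ∈ s, ∫ ω in A e, z ^ (M ω - 1) ∂P := by
    rw [integral_mul_const, mul_comm]
    congr 1
    simp_rw [← integral_indicator (hA _)]
    rw [← integral_finsetSum _ fun e _ ↦
      (integrable_comp_occurrences hA s (fun k ↦ z ^ (k - 1))).indicator (hA e)]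
    congr 1 with ω
    conv_lhs => rw [hMdef, occurrences, Nat.cast_sum, Finset.sum_mul]
    refine Finset.sum_congr rfl fun e _ ↦ ?_
    by_cases h : ω ∈ A e <;> simp [h, occurrences]
  have hprod (e : ι) (he : e ∈ s) : ∫ ω in A e, z ^ occurrences A (s \ B e) ω ∂P =
      P.real (A e) * ∫ ω, z ^ occurrences A (s \ B e) ω ∂P := by
    have h := (hind e he).integral_fun_comp_mul_comp (f := id) (g := fun k ↦ z ^ k)
      (measurable_one.indicator (hA e)).aemeasurable (measurable_occurrences hA _).aemeasurable
      aestronglyMeasurable_id Measurable.of_discrete.aestronglyMeasurable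
    rw [← integral_indicator (hA e)]
    convert h using 1
    · congr 1 with ω
      by_cases hω : ω ∈ A e <;> simp [hω]
    · simp [integral_indicator (hA e)]
  -- For each `e`, drop the neighbours from the exponent, factor by independence, then put them
  -- back: the two replacements give the two kinds of error term.
  calc ‖∫ ω, M ω * z ^ (M ω - 1) * η ∂P - η * (∑ e ∈ s, P.real (A e) : ℝ) * ∫ ω, z ^ M ω ∂P‖
      = ‖η * ∑ e ∈ s, ((∫ ω in A e, z ^ (M ω - 1) ∂P
            - ∫ ω in A e, z ^ occurrences A (s \ B e) ω ∂P)
          + P.real (A e) * (∫ ω, z ^ occurrences A (s \ B e) ω ∂P - ∫ ω, z ^ M ω ∂P))‖ := by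
        rw [hderiv, mul_assoc, ← mul_sub]
        congr 2
        push_cast
        rw [Finset.sum_mul, ← Finset.sum_sub_distrib]
        refine Finset.sum_congr rfl fun e he ↦ ?_
        rw [hprod e he]
        ring
    _ ≤ ‖η‖ * ∑ e ∈ s, (‖η‖ * ∑ e' ∈ (B e).erase e, P.real (A e ∩ A e') +
          P.real (A e) * (‖η‖ * ∑ e' ∈ B e, P.real (A e'))) := by
        rw [norm_mul]
        gcongr
        refine norm_sum_le_of_le _ fun e he ↦ (norm_add_le _ _).trans (add_le_add ?_ ?_)
        · refine (norm_setIntegral_pow_occurrences_sub_le hA (hB e he) (hmem e he) hz).trans ?_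
          gcongr
        · rw [norm_mul, Complex.norm_real, Real.norm_of_nonneg measureReal_nonneg]
          gcongr
          refine (norm_integral_pow_occurrences_sub_le hA (hB e he) hz).trans ?_
          gcongr
    _ = _ := by
        rw [Finset.mul_sum, Finset.mul_sum]
        refine Finset.sum_congr rfl fun e _ ↦ ?_
        ring

end Dissociated

/-! ### Monochromatic sets under a uniform coloring -/

instance (V : Type*) (r : ℕ) : DiscreteMeasurableSpace (UniformHypergraph V r) :=
  ⟨fun _ ↦ trivial⟩

instance (V : Type*) [Finite V] (r : ℕ) : Finite (UniformHypergraph V r) :=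
  Finite.of_injective UniformHypergraph.edges fun _ _ h ↦ UniformHypergraph.ext h

/-- A common vertex forces both colors to agree. Joint probabilities of overlapping sets thus reduce
to that of a single set. -/
theorem isMonochromatic_union {V C : Type*} [DecidableEq V] {x : V → C} {e f : Finset V}
    (h : ¬ Disjoint e f) :
    IsMonochromatic x (e ∪ f) ↔ IsMonochromatic x e ∧ IsMonochromatic x f := by
  obtain ⟨w, hwe, hwf⟩ := Finset.not_disjoint_iff.1 h
  refine ⟨fun h ↦ ⟨fun v hv v' hv' ↦ h v (Finset.mem_union_left _ hv) v'
    (Finset.mem_union_left _ hv'), fun v hv v' hv' ↦ h v (Finset.mem_union_right _ hv) v'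
    (Finset.mem_union_right _ hv')⟩, fun ⟨he, hf⟩ ↦ ?_⟩
  have hw : ∀ v ∈ e ∪ f, x v = x w := fun v hv ↦
    (Finset.mem_union.1 hv).elim (fun h ↦ he v h w hwe) fun h ↦ hf v h w hwf
  exact fun v hv v' hv' ↦ (hw v hv).trans (hw v' hv').symm

theorem isMonochromatic_iff_restrict {V C : Type*} {x : V → C} {e s : Finset V} (h : e ⊆ s) :
    IsMonochromatic x e ↔ ∀ v : s, (v : V) ∈ e → ∀ v' : s, (v' : V) ∈ e → x v = x v' :=
  ⟨fun hx v hv v' hv' ↦ hx v hv v' hv', fun hx v hv v' hv' ↦ hx ⟨v, h hv⟩ hv ⟨v', h hv'⟩ hv'⟩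

/-- The number of `r`-sets meeting a fixed `r`-set in exactly `k` points. -/
theorem card_filter_card_inter_eq_le {V : Type*} [Fintype V] [DecidableEq V] {r k : ℕ}
    {e : Finset V} (he : e.card = r) :
    ((Finset.powersetCard r (Finset.univ : Finset V)).filter fun f ↦ (e ∩ f).card = k).card ≤
      r.choose k * Fintype.card V ^ (r - k) := by
  calc _ ≤ (Finset.powersetCard k e ×ˢ Finset.powersetCard (r - k)
        (Finset.univ : Finset V)).card := by
        refine Finset.card_le_card_of_injOn (fun f ↦ (e ∩ f, f \ e)) (fun f hf ↦ ?_) ?_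
        · simp only [Finset.coe_filter, Finset.mem_powersetCard, Set.mem_ofPred_eq] at hf
          simp only [Finset.coe_product, Set.mem_prod, Finset.mem_coe, Finset.mem_powersetCard,
            Finset.inter_subset_left, Finset.subset_univ, true_and, hf.2]
          rw [Finset.card_sdiff, hf.1.2, hf.2]
        · intro f _ g _ hfg
          simp only [Prod.mk.injEq] at hfg
          rw [← Finset.sdiff_union_inter f e, ← Finset.sdiff_union_inter g e, hfg.2,
            Finset.inter_comm f, hfg.1, Finset.inter_comm g]
    _ ≤ _ := by
        rw [Finset.card_product, Finset.card_powersetCard, Finset.card_powersetCard, he,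
          Finset.card_univ]
        gcongr
        exact Nat.choose_le_pow _ _

/-- The event that `e` is monochromatic under the random coloring `X`. -/
def monoEvent {Ω V C : Type*} (X : Ω → V → C) (e : Finset V) : Set Ω :=
  {ω | IsMonochromatic (X ω) e}

theorem measurableSet_monoEvent {Ω V : Type*} [MeasurableSpace Ω] [Finite V] {c : ℕ}
    {X : Ω → V → Fin c} (hX : Measurable X) (e : Finset V) :
    MeasurableSet (monoEvent X e) :=
  hX (Set.to_countable {x | IsMonochromatic x e}).measurableSet

/-- Split by the common color: `c` disjoint events, each of probability `c ^ (-e.card)`. -/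
theorem measureReal_monoEvent {Ω V : Type*} [MeasurableSpace Ω] {P : Measure Ω} {c : ℕ}
    {X : Ω → V → Fin c} (hX : IsUniformColoring P X) {e : Finset V} (he : e.Nonempty)
    (hc : c ≠ 0) : P.real (monoEvent X e) = ((c : ℝ) ^ (e.card - 1))⁻¹ := by
  obtain ⟨w, hw⟩ := he
  have := hX.indep.isProbabilityMeasure
  have hset : monoEvent X e = ⋃ a ∈ (Finset.univ : Finset (Fin c)),
      ⋂ v ∈ e, (fun ω ↦ X ω v) ⁻¹' {a} := by
    ext ω
    simp only [monoEvent, Set.mem_ofPred_eq, Finset.mem_univ, Set.iUnion_true, Set.mem_iUnion,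
      Set.mem_iInter, Set.mem_preimage, Set.mem_singleton_iff]
    exact ⟨fun h ↦ ⟨X ω w, fun v hv ↦ h v hv w hw⟩,
      fun ⟨a, ha⟩ v hv v' hv' ↦ (ha v hv).trans (ha v' hv').symm⟩
  have hXv (v : V) : Measurable fun ω ↦ X ω v := (measurable_pi_apply v).comp hX.measurable
  have hatom (a : Fin c) : P.real (⋂ v ∈ e, (fun ω ↦ X ω v) ⁻¹' {a}) = (1 / (c : ℝ)) ^ e.card := by
    rw [measureReal_def, hX.indep.measure_inter_preimage_eq_mul e
      (sets := fun _ ↦ {a}) (fun _ _ ↦ measurableSet_singleton a), ENNReal.toReal_prod,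
      ← Finset.prod_const]
    exact Finset.prod_congr rfl fun v _ ↦ hX.prob v a
  rw [hset, measureReal_biUnion_finset]
  · simp_rw [hatom]
    obtain ⟨k, hk⟩ : ∃ k, e.card = k + 1 :=
      Nat.exists_eq_succ_of_ne_zero (Finset.card_ne_zero_of_mem hw)
    rw [hk]
    have : (c : ℝ) ≠ 0 := by exact_mod_cast hc
    simp only [Finset.sum_const, Finset.card_univ, Fintype.card_fin, nsmul_eq_mul,
      Nat.add_sub_cancel, one_div, inv_pow, pow_succ]
    field_simp
  · intro a _ b _ hab
    refine Set.disjoint_left.2 fun ω ha hb ↦ hab ?_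
    simp only [Set.mem_iInter, Set.mem_preimage, Set.mem_singleton_iff] at ha hb
    exact (ha w hw).symm.trans (hb w hw)
  · exact fun a _ ↦ Finset.measurableSet_biInter _ fun v _ ↦ hXv v (measurableSet_singleton a)

section Coloring

variable {Ω : Type*} [MeasurableSpace Ω] {P : Measure Ω}
  {V : Type*} [Fintype V] [DecidableEq V] {c : ℕ} {X : Ω → V → Fin c}

/-- The two variables are functions of the colorings of `e` and of its complement, which are
independent. -/
theorem indepFun_monoEvent_occurrences (hX : IsUniformColoring P X) (e : Finset V)
    {s : Finset (Finset V)} (hs : ∀ f ∈ s, Disjoint e f) :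
    IndepFun ((monoEvent X e).indicator (1 : Ω → ℂ)) (occurrences (monoEvent X) s) P := by
  classical
  have hXv (v : V) : Measurable fun ω ↦ X ω v := (measurable_pi_apply v).comp hX.measurable
  have h := hX.indep.indepFun_finset e eᶜ disjoint_compl_right hXv
  let φ : (e → Fin c) → ℂ := fun y ↦ if ∀ v : e, (v : V) ∈ e → ∀ v' : e, (v' : V) ∈ e →
    y v = y v' then 1 else 0
  let ψ : ((eᶜ : Finset V) → Fin c) → ℕ := fun y ↦ ∑ f ∈ s,
    if ∀ v : (eᶜ : Finset V), (v : V) ∈ f → ∀ v' : (eᶜ : Finset V), (v' : V) ∈ f → y v = y v'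
    then 1 else 0
  have h' := h.comp (φ := φ) (ψ := ψ) (measurable_of_countable _) (measurable_of_countable _)
  convert h' using 1
  · ext ω
    simp only [Set.indicator_apply, monoEvent, Set.mem_ofPred_eq, Pi.one_apply,
      isMonochromatic_iff_restrict (Finset.Subset.refl e), Function.comp_apply, φ]
  · ext ω
    simp only [occurrences, Set.indicator_apply, monoEvent, Set.mem_ofPred_eq, Pi.one_apply,
      Function.comp_apply, ψ]
    refine Finset.sum_congr rfl fun f hf ↦ ?_
    simp only [isMonochromatic_iff_restrict
      (Finset.subset_compl_comm.1 ((Finset.subset_compl_iff_disjoint_right).2 (hs f hf)))]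

/-- The second-order term in the Poisson approximation of the number of monochromatic
`r`-sets. -/
theorem sum_monoEvent_overlap_le (hX : IsUniformColoring P X) {r : ℕ} (hr : 2 ≤ r) (hc : c ≠ 0)
    [Nonempty V] :
    ∑ e ∈ Finset.powersetCard r (Finset.univ : Finset V),
      (∑ f ∈ ((Finset.powersetCard r (Finset.univ : Finset V)).filter
          fun f ↦ ¬ Disjoint e f).erase e, P.real (monoEvent X e ∩ monoEvent X f) +
        P.real (monoEvent X e) * ∑ f ∈ (Finset.powersetCard r (Finset.univ : Finset V)).filter
          fun f ↦ ¬ Disjoint e f, P.real (monoEvent X f)) ≤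
    ((Fintype.card V).choose r : ℝ) / (c : ℝ) ^ (r - 1) *
      (2 * ∑ k ∈ Finset.Ico 1 r, (r.choose k : ℝ) * (Fintype.card V / c : ℝ) ^ (r - k) +
        (Fintype.card V / c : ℝ) ^ (r - 1)) := by
  set J := Finset.powersetCard r (Finset.univ : Finset V) with hJ
  set N : ℝ := ((Fintype.card V : ℕ) : ℝ) with hN
  have hN1 : 1 ≤ N := by
    rw [hN]; exact_mod_cast Fintype.card_pos
  have hc1 : (1 : ℝ) ≤ c := by exact_mod_cast Nat.one_le_iff_ne_zero.2 hc
  have hcard : ∀ f ∈ J, f.card = r := fun f hf ↦ (Finset.mem_powersetCard.1 hf).2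
  have hne : ∀ f ∈ J, f.Nonempty := fun f hf ↦ Finset.card_pos.1 (by have := hcard f hf; omega)
  have hprob : ∀ f ∈ J, P.real (monoEvent X f) = ((c : ℝ) ^ (r - 1))⁻¹ := fun f hf ↦ by
    rw [measureReal_monoEvent hX (hne f hf) hc, hcard f hf]
  set L : ℝ := ((c : ℝ) ^ (r - 1))⁻¹ with hL
  have hL0 : 0 ≤ L := by positivity
  have hterm : ∀ e ∈ J, (∑ f ∈ (J.filter fun f ↦ ¬ Disjoint e f).erase e,
      P.real (monoEvent X e ∩ monoEvent X f) +
        P.real (monoEvent X e) * ∑ f ∈ J.filter fun f ↦ ¬ Disjoint e f, P.real (monoEvent X f)) ≤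
      L * (2 * ∑ k ∈ Finset.Ico 1 r, (r.choose k : ℝ) * (N / c) ^ (r - k) +
        (N / c) ^ (r - 1)) := by
    intro e he
    set B := J.filter fun f ↦ ¬ Disjoint e f with hB
    have heB : e ∈ B := Finset.mem_filter.2 ⟨he, by
      rw [disjoint_self]; exact (hne e he).ne_empty⟩
    have hmaps : ∀ f ∈ B.erase e, (e ∩ f).card ∈ Finset.Ico 1 r := by
      intro f hf
      obtain ⟨hfe, hfB⟩ := Finset.mem_erase.1 hf
      obtain ⟨hfJ, hd⟩ := Finset.mem_filter.1 hfB
      refine Finset.mem_Ico.2 ⟨Finset.card_pos.2 (Finset.not_disjoint_iff_nonempty_inter.1 hd), ?_⟩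
      by_contra! hle
      have h1 : e ∩ f = e := Finset.eq_of_subset_of_card_le Finset.inter_subset_left
        (by rw [hcard e he]; exact hle)
      have h2 : e ∩ f = f := Finset.eq_of_subset_of_card_le Finset.inter_subset_right
        (by rw [hcard f hfJ]; exact hle)
      exact hfe (h2.symm.trans h1)
    -- With `k` common vertices the union has `2 r - k` vertices, so the joint probability is `L * c
    -- ^ (-(r - k))`. The product `L * L` is no larger since `1 ≤ k`; hence the factor `2`.
    have hpair : ∀ f ∈ B.erase e, P.real (monoEvent X e ∩ monoEvent X f) +
        P.real (monoEvent X e) * P.real (monoEvent X f) ≤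
        2 * L * ((c : ℝ) ^ (r - (e ∩ f).card))⁻¹ := by
      intro f hf
      have hk := Finset.mem_Ico.1 (hmaps f hf)
      obtain ⟨hfJ, hd⟩ := Finset.mem_filter.1 (Finset.mem_of_mem_erase hf)
      have hinter : monoEvent X e ∩ monoEvent X f = monoEvent X (e ∪ f) :=
        Set.ext fun ω ↦ (isMonochromatic_union hd).symm
      have hu := Finset.card_union_add_card_inter e f
      rw [hcard e he, hcard f hfJ] at hu
      have hexp : (e ∪ f).card - 1 = (r - 1) + (r - (e ∩ f).card) := by omega
      rw [hinter, measureReal_monoEvent hX ((hne e he).mono Finset.subset_union_left) hc, hexp,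
        hprob e he, hprob f hfJ, pow_add, mul_inv, ← hL, two_mul, add_mul]
      gcongr
      rw [hL]
      gcongr
      exact hk.1
    -- The term `f = e` occurs only in the product sum and leaves `L * L`, which becomes the last
    -- summand by `1 ≤ N`.
    calc _ = ∑ f ∈ B.erase e, (P.real (monoEvent X e ∩ monoEvent X f) +
          P.real (monoEvent X e) * P.real (monoEvent X f)) + L * L := by
          rw [← Finset.add_sum_erase _ _ heB, Finset.sum_add_distrib, ← Finset.mul_sum,
            hprob e he]
          ring
      _ ≤ ∑ f ∈ B.erase e, 2 * L * ((c : ℝ) ^ (r - (e ∩ f).card))⁻¹ + L * (N / c) ^ (r - 1) := by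
          gcongr with f hf
          · exact hpair f hf
          · rw [hL, ← inv_pow, div_eq_mul_inv]
            gcongr
            exact le_mul_of_one_le_left (by positivity) hN1
      _ = ∑ k ∈ Finset.Ico 1 r, ∑ f ∈ (B.erase e).filter fun f ↦ (e ∩ f).card = k,
            2 * L * ((c : ℝ) ^ (r - (e ∩ f).card))⁻¹ + L * (N / c) ^ (r - 1) := by
          rw [Finset.sum_fiberwise_of_maps_to hmaps]
      _ ≤ ∑ k ∈ Finset.Ico 1 r, ((r.choose k : ℝ) * N ^ (r - k)) *
            (2 * L * ((c : ℝ) ^ (r - k))⁻¹) + L * (N / c) ^ (r - 1) := by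
          gcongr with k hk
          rw [Finset.sum_congr rfl (g := fun _ ↦ 2 * L * ((c : ℝ) ^ (r - k))⁻¹) fun f hf ↦ by
            rw [(Finset.mem_filter.1 hf).2], Finset.sum_const, nsmul_eq_mul]
          gcongr
          have h1 : ((B.erase e).filter fun f ↦ (e ∩ f).card = k).card ≤
              r.choose k * Fintype.card V ^ (r - k) :=
            (Finset.card_le_card (Finset.filter_subset_filter _
              ((Finset.erase_subset _ _).trans (Finset.filter_subset _ _)))).trans
              (card_filter_card_inter_eq_le (hcard e he))
          rw [hN]
          exact_mod_cast h1
      _ = _ := by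
          rw [mul_add, Finset.mul_sum, Finset.mul_sum]
          congr 1
          refine Finset.sum_congr rfl fun k _ ↦ ?_
          rw [div_pow]
          ring
  refine (Finset.sum_le_sum hterm).trans_eq ?_
  rw [Finset.sum_const, hJ, Finset.card_powersetCard, Finset.card_univ, nsmul_eq_mul, hL]
  ring

end Coloring

/-! ### Integrating out the hypergraphs -/

open scoped Classical in
theorem pow_monoCount {V C : Type*} [Fintype V] {r : ℕ} (H : UniformHypergraph V r) (x : V → C)
    (z : ℂ) : z ^ monoCount H x =
      ∏ e : {e : Finset V // e.card = r}, if IsMonochromatic x e then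
        (if e.1 ∈ H.edges then z else 1) else 1 := by
  have hfilter : H.edges.filter (IsMonochromatic x) =
      (Finset.powersetCard r Finset.univ).filter fun e ↦ IsMonochromatic x e ∧ e ∈ H.edges := by
    ext e
    simp only [Finset.mem_filter, Finset.mem_powersetCard, Finset.subset_univ, true_and]
    exact ⟨fun h ↦ ⟨H.card_eq e h.1, h.2, h.1⟩, fun h ↦ ⟨h.2.2, h.2.1⟩⟩
  rw [← Finset.prod_subtype (Finset.powersetCard r Finset.univ)
    (fun e ↦ by simp [Finset.mem_powersetCard])
    (fun e ↦ if IsMonochromatic x e then (if e ∈ H.edges then z else 1) else 1),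
    monoCount, hfilter, ← Finset.prod_const, Finset.prod_filter]
  exact Finset.prod_congr rfl fun e _ ↦ by rw [ite_and]

open scoped Classical in
theorem pow_occurrences_monoEvent {Ω V C : Type*} [Fintype V] {r : ℕ} (X : Ω → V → C) (ω : Ω)
    (z : ℂ) : z ^ occurrences (monoEvent X) (Finset.powersetCard r Finset.univ) ω =
      ∏ e : {e : Finset V // e.card = r}, if IsMonochromatic (X ω) e then z else 1 := by
  rw [← Finset.prod_subtype (Finset.powersetCard r Finset.univ)
    (fun e ↦ by simp [Finset.mem_powersetCard])
    (fun e ↦ if IsMonochromatic (X ω) e then z else 1), occurrences, ← Finset.prod_pow_eq_pow_sum]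
  refine Finset.prod_congr rfl fun e _ ↦ ?_
  by_cases h : IsMonochromatic (X ω) e <;> simp [monoEvent, h]

open scoped Classical in
/-- The contribution of one potential hyperedge to a joint generating function, given the pair of
membership propositions. -/
noncomputable def edgeWeight (z w : ℂ) (q : Prop × Prop) : ℂ :=
  (if q.1 then z else 1) * (if q.2 then w else 1)

section

variable {Ω : Type*} [MeasurableSpace Ω] {P : Measure Ω} [IsProbabilityMeasure P]

/-- Expand `(1 + 1_A (z - 1)) (1 + 1_B (w - 1))` and integrate. -/
theorem integral_edgeWeight {A B : Set Ω} (hA : MeasurableSet A) (hB : MeasurableSet B)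
    (z w : ℂ) : ∫ ω, edgeWeight z w (ω ∈ A, ω ∈ B) ∂P =
      1 + (P.real A * (z - 1) + P.real B * (w - 1) + P.real (A ∩ B) * ((z - 1) * (w - 1))) := by
  have h : (fun ω ↦ edgeWeight z w (ω ∈ A, ω ∈ B)) = (fun _ ↦ 1) + (A.indicator (fun _ ↦ z - 1) +
      B.indicator (fun _ ↦ w - 1) + (A ∩ B).indicator (fun _ ↦ (z - 1) * (w - 1))) := by
    ext ω
    by_cases h1 : ω ∈ A <;> by_cases h2 : ω ∈ B <;> simp [edgeWeight, h1, h2]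
    ring
  have hi {S : Set Ω} (hS : MeasurableSet S) (a : ℂ) : Integrable (S.indicator fun _ ↦ a) P :=
    (integrable_const a).indicator hS
  rw [h, integral_add' (integrable_const _)
    (((hi hA _).add (hi hB _)).add (hi (hA.inter hB) _)),
    integral_add' ((hi hA _).add (hi hB _)) (hi (hA.inter hB) _),
    integral_add' (hi hA _) (hi hB _), integral_indicator_const _ hA, integral_indicator_const _ hB,
    integral_indicator_const _ (hA.inter hB)]
  simp

open scoped Classical in
/-- Integrating out the random hypergraphs from the joint generating function. -/
theorem integral_pow_monoCount {n r c : ℕ} {p ρ : ℝ}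
    {H : Ω → UniformHypergraph (Fin n) r × UniformHypergraph (Fin n) r}
    (hH : IsCorrelatedErdosRenyi P H p ρ) {X : Ω → Fin n → Fin c} (hX : Measurable X)
    (hHX : IndepFun H X P) (z w : ℂ) :
    ∫ ω, z ^ monoCount (H ω).1 (X ω) * w ^ monoCount (H ω).2 (X ω) ∂P =
      ∫ ω, (1 + (p * (z - 1) + p * (w - 1) + (ρ + p ^ 2) * ((z - 1) * (w - 1)))) ^
        occurrences (monoEvent X) (Finset.powersetCard r Finset.univ) ω ∂P := by
  let G : (UniformHypergraph (Fin n) r × UniformHypergraph (Fin n) r) × (Fin n → Fin c) → ℂ :=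
    fun y ↦ ∏ e : {e : Finset (Fin n) // e.card = r}, if IsMonochromatic y.2 e then
      edgeWeight z w (e.1 ∈ y.1.1.edges, e.1 ∈ y.1.2.edges) else 1
  have hG (ω : Ω) : z ^ monoCount (H ω).1 (X ω) * w ^ monoCount (H ω).2 (X ω) =
      G (H ω, X ω) := by
    rw [pow_monoCount, pow_monoCount, ← Finset.prod_mul_distrib]
    refine Finset.prod_congr rfl fun e _ ↦ ?_
    by_cases h : IsMonochromatic (X ω) e <;> simp [h, edgeWeight]
    congr!
  have hmap := (indepFun_iff_map_prod_eq_prod_map_map hH.measurable.aemeasurable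
    hX.aemeasurable).1 hHX
  have := Measure.isProbabilityMeasure_map (μ := P) hH.measurable.aemeasurable
  have := Measure.isProbabilityMeasure_map (μ := P) hX.aemeasurable
  have hmeas (e : Finset (Fin n)) (i : UniformHypergraph (Fin n) r × UniformHypergraph (Fin n) r →
      UniformHypergraph (Fin n) r) : MeasurableSet {ω | e ∈ (i (H ω)).edges} :=
    hH.measurable (MeasurableSet.of_discrete (s := {h | e ∈ (i h).edges}))
  simp_rw [hG]
  rw [← integral_map (f := G) (hH.measurable.prodMk hX).aemeasurable
    (measurable_of_finite G).aestronglyMeasurable, hmap, integral_prod_symm _ .of_finite,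
    integral_map hX.aemeasurable (measurable_of_finite _).aestronglyMeasurable]
  congr 1 with ω
  rw [integral_map hH.measurable.aemeasurable (measurable_of_finite _).aestronglyMeasurable,
    pow_occurrences_monoEvent]
  -- With the coloring frozen by Fubini, each factor depends on the memberships of one edge only.
  have hprod := hH.indep.integral_fun_prod_comp
    (f := fun e q ↦ if IsMonochromatic (X ω) e.1 then edgeWeight z w q else 1)
    (fun e ↦ ((measurable_of_finite fun h : UniformHypergraph (Fin n) r ×
      UniformHypergraph (Fin n) r ↦ ((e.1 ∈ h.1.edges, e.1 ∈ h.2.edges) : Prop × Prop)).comp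
        hH.measurable).aemeasurable)
    (fun e ↦ (measurable_of_finite _).aestronglyMeasurable)
  refine hprod.trans (Finset.prod_congr rfl fun e _ ↦ ?_)
  by_cases h : IsMonochromatic (X ω) e
  · simp only [h, if_true]
    have := integral_edgeWeight (P := P) (hmeas e Prod.fst) (hmeas e Prod.snd) z w
    have hboth : P.real ({ω | e.1 ∈ (H ω).1.edges} ∩ {ω | e.1 ∈ (H ω).2.edges}) = ρ + p ^ 2 :=
      hH.prob_both e e.2
    rw [hH.prob_fst e e.2, hH.prob_snd e e.2, hboth] at this
    simpa using this
  · simp [h]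

end

/-! ### Quantitative bound for the joint generating function -/

/-- This is the generating function of one edge: a convex combination of `1`, `z`, `w`, `z w` with
weights `1 - 2 p + q`, `p - q`, `p - q`, `q`. The first is at least `(1 - p) ^ 2`. -/
theorem norm_one_add_weight_le {p q : ℝ} (hq : p ^ 2 ≤ q) (hqp : q ≤ p) {z w : ℂ}
    (hz : ‖z‖ ≤ 1) (hw : ‖w‖ ≤ 1) :
    ‖1 + (p * (z - 1) + p * (w - 1) + q * ((z - 1) * (w - 1)))‖ ≤ 1 := by
  have h0 : 0 ≤ 1 - 2 * p + q := by nlinarith [sq_nonneg (1 - p)]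
  have hq0 : 0 ≤ q := (sq_nonneg p).trans hq
  calc _ = ‖((1 - 2 * p + q : ℝ) : ℂ) + ((p - q : ℝ) : ℂ) * z + ((p - q : ℝ) : ℂ) * w
        + (q : ℂ) * (z * w)‖ := by congr 1; push_cast; ring
    _ ≤ (1 - 2 * p + q) + (p - q) * ‖z‖ + (p - q) * ‖w‖ + q * (‖z‖ * ‖w‖) := by
        refine norm_add₄_le.trans_eq ?_
        simp only [norm_mul, Complex.norm_real, Real.norm_of_nonneg h0, Real.norm_of_nonneg hq0,
          Real.norm_of_nonneg (sub_nonneg.2 hqp)]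
    _ ≤ (1 - 2 * p + q) + (p - q) * 1 + (p - q) * 1 + q * (1 * 1) := by
        have : 0 ≤ p - q := sub_nonneg.2 hqp
        gcongr
    _ = 1 := by ring

theorem norm_weight_le {p q : ℝ} (hq : p ^ 2 ≤ q) (hqp : q ≤ p) {z w : ℂ}
    (hz : ‖z‖ ≤ 1) (hw : ‖w‖ ≤ 1) :
    ‖p * (z - 1) + p * (w - 1) + q * ((z - 1) * (w - 1))‖ ≤ 8 * p := by
  have hq0 : 0 ≤ q := (sq_nonneg p).trans hq
  have h2 {x : ℂ} (hx : ‖x‖ ≤ 1) : ‖x - 1‖ ≤ 2 := by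
    refine (norm_sub_le _ _).trans ?_
    rw [norm_one]; linarith
  have hp0 : 0 ≤ p := hq0.trans hqp
  calc _ ≤ p * ‖z - 1‖ + p * ‖w - 1‖ + q * (‖z - 1‖ * ‖w - 1‖) := by
        refine norm_add₃_le.trans_eq ?_
        simp only [norm_mul, Complex.norm_real, Real.norm_of_nonneg hp0, Real.norm_of_nonneg hq0]
    _ ≤ p * 2 + p * 2 + p * (2 * 2) := by gcongr <;> exact h2 ‹_›
    _ = 8 * p := by ring

/-- Poisson approximation of the joint generating function of the two numbers of monochromatic
hyperedges. -/
theorem norm_integral_pow_monoCount_sub_exp_le {Ω : Type*} [MeasurableSpace Ω] {P : Measure Ω}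
    [IsProbabilityMeasure P] {n r c : ℕ} {p ρ : ℝ} (hr : 2 ≤ r) (hn : n ≠ 0)
    (hρ : 0 ≤ ρ) (hρp : ρ ≤ p * (1 - p))
    {H : Ω → UniformHypergraph (Fin n) r × UniformHypergraph (Fin n) r}
    (hH : IsCorrelatedErdosRenyi P H p ρ) {X : Ω → Fin n → Fin c} (hX : IsUniformColoring P X)
    (hHX : IndepFun H X P) {z w : ℂ} (hz : ‖z‖ ≤ 1) (hw : ‖w‖ ≤ 1) {m : ℂ}
    (hm : m = ((n.choose r * p / c ^ (r - 1) : ℝ) : ℂ) * (z - 1)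
      + ((n.choose r * p / c ^ (r - 1) : ℝ) : ℂ) * (w - 1)
      + ((n.choose r * (ρ + p ^ 2) / c ^ (r - 1) : ℝ) : ℂ) * ((z - 1) * (w - 1))) :
    ‖∫ ω, z ^ monoCount (H ω).1 (X ω) * w ^ monoCount (H ω).2 (X ω) ∂P - Complex.exp m‖ ≤
      Real.exp (2 * ‖m‖) * (64 * (n.choose r * p / c ^ (r - 1)) *
        (2 * ∑ k ∈ Finset.Ico 1 r, r.choose k * (p * (n / c : ℝ) ^ (r - k)) +
          p * (n / c : ℝ) ^ (r - 1))) := by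
  classical
  have : Nonempty (Fin n) := ⟨⟨0, Nat.pos_of_ne_zero hn⟩⟩
  obtain ⟨ω₀⟩ : Nonempty Ω := nonempty_of_isProbabilityMeasure P
  -- The color of vertex `0` is an element of `Fin c`.
  have hc : c ≠ 0 := by
    have := (X ω₀ ⟨0, Nat.pos_of_ne_zero hn⟩).pos
    omega
  have hq : p ^ 2 ≤ ρ + p ^ 2 := le_add_of_nonneg_left hρ
  have hqp : ρ + p ^ 2 ≤ p := by nlinarith
  set J := Finset.powersetCard r (Finset.univ : Finset (Fin n)) with hJ
  have hsum : ∑ e ∈ J, P.real (monoEvent X e) = n.choose r / (c : ℝ) ^ (r - 1) := by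
    rw [Finset.sum_congr rfl (g := fun _ ↦ ((c : ℝ) ^ (r - 1))⁻¹) fun e he ↦ by
      have hcard := (Finset.mem_powersetCard.1 he).2
      rw [measureReal_monoEvent hX (Finset.card_pos.1 (by omega)) hc, hcard],
      Finset.sum_const, hJ, Finset.card_powersetCard, Finset.card_univ, Fintype.card_fin,
      nsmul_eq_mul, div_eq_mul_inv]
  set η : ℂ := p * (z - 1) + p * (w - 1) + (ρ + p ^ 2) * ((z - 1) * (w - 1)) with hη
  have hη1 : ‖1 + η‖ ≤ 1 := by
    have := norm_one_add_weight_le hq hqp hz hw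
    push_cast at this
    exact this
  have hη2 : ‖η‖ ≤ 8 * p := by
    have := norm_weight_le hq hqp hz hw
    push_cast at this
    exact this
  have key := norm_integral_one_add_pow_occurrences_sub_exp_le (P := P)
    (A := monoEvent X) (fun e ↦ measurableSet_monoEvent hX.measurable e) (s := J)
    (B := fun e ↦ J.filter fun f ↦ ¬ Disjoint e f) (fun e _ ↦ Finset.filter_subset _ _)
    (fun e he ↦ Finset.mem_filter.2 ⟨he, by
      have hcard := (Finset.mem_powersetCard.1 he).2
      rw [disjoint_self]
      exact (Finset.card_pos.1 (by omega)).ne_empty⟩)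
    (fun e _ ↦ indepFun_monoEvent_occurrences hX e fun f hf ↦ by
      simp only [Finset.mem_sdiff, Finset.mem_filter, not_and, not_not] at hf
      exact hf.2 hf.1) hη1
  have hmη : η * (∑ e ∈ J, P.real (monoEvent X e) : ℝ) = m := by
    rw [hsum, hm, hη]
    push_cast
    ring
  rw [hmη, ← integral_pow_monoCount hH hX.measurable hHX z w] at key
  refine key.trans ?_
  have hb := sum_monoEvent_overlap_le hX hr hc
  rw [Fintype.card_fin] at hb
  have hp0 : 0 ≤ p := by nlinarith [sq_nonneg p]
  calc _ ≤ Real.exp (2 * ‖m‖) * ((8 * p) ^ 2 * (n.choose r / (c : ℝ) ^ (r - 1) *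
      (2 * ∑ k ∈ Finset.Ico 1 r, (r.choose k : ℝ) * (n / c : ℝ) ^ (r - k) +
        (n / c : ℝ) ^ (r - 1)))) := by
        gcongr
    _ = _ := by
        have : ∑ k ∈ Finset.Ico 1 r, (r.choose k : ℝ) * (p * (n / c : ℝ) ^ (r - k)) =
            p * ∑ k ∈ Finset.Ico 1 r, (r.choose k : ℝ) * (n / c : ℝ) ^ (r - k) := by
          rw [Finset.mul_sum]
          exact Finset.sum_congr rfl fun _ _ ↦ by ring
        rw [this]
        ring

/-! ### Overlaps are asymptotically negligible -/

theorem tendsto_zero_of_tendsto_pow_zero {a : ℕ → ℝ} (ha : ∀ n, 0 ≤ a n) {m : ℕ}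
    (h : Tendsto (fun n ↦ a n ^ m) atTop (𝓝 0)) : Tendsto a atTop (𝓝 0) := by
  rw [Metric.tendsto_nhds]
  intro ε hε
  filter_upwards [h.eventually_lt_const (pow_pos hε m)] with n hn
  rw [Real.dist_0_eq_abs, abs_of_nonneg (ha n)]
  exact lt_of_pow_lt_pow_left₀ m hε.le hn

theorem pow_le_mul_choose {n r : ℕ} (h : 2 * r ≤ n) :
    (n : ℝ) ^ r ≤ 2 ^ r * r.factorial * n.choose r := by
  have h1 : n ^ r ≤ 2 ^ r * (n + 1 - r) ^ r := by
    rw [← mul_pow]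
    exact Nat.pow_le_pow_left (by omega) r
  have h2 : (n + 1 - r) ^ r ≤ r.factorial * n.choose r := by
    rw [← Nat.descFactorial_eq_factorial_mul_choose]
    exact Nat.pow_sub_le_descFactorial n r
  rw [mul_assoc]
  exact_mod_cast h1.trans (Nat.mul_le_mul_left _ h2)

/-- If the expected number of monochromatic hyperedges converges, then overlapping pairs of
hyperedges are negligible. -/
theorem tendsto_mul_div_pow_zero {r : ℕ} {p : ℕ → ℝ} {c : ℕ → ℕ} (hp : ∀ n, 0 ≤ p n)
    (hp1 : ∀ n, p n ≤ 1) {l : ℝ}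
    (h : Tendsto (fun n ↦ (n.choose r : ℝ) * p n / (c n : ℝ) ^ (r - 1)) atTop (𝓝 l))
    {j : ℕ} (hj : 1 ≤ j) (hjr : j < r) :
    Tendsto (fun n : ℕ ↦ p n * (n / c n : ℝ) ^ j) atTop (𝓝 0) := by
  -- The top exponent gains a factor `1 / n`, because `n ^ r` is of the order of `n.choose r`.
  have hu : Tendsto (fun n : ℕ ↦ p n * (n / c n : ℝ) ^ (r - 1)) atTop (𝓝 0) := by
    have hlim := (h.const_mul (2 ^ r * (r.factorial : ℝ))).mul
      (tendsto_inv_atTop_nhds_zero_nat (𝕜 := ℝ))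
    rw [mul_zero] at hlim
    refine squeeze_zero' (.of_forall fun n ↦ mul_nonneg (hp n) (by positivity)) ?_ hlim
    filter_upwards [eventually_ge_atTop (2 * r), eventually_ge_atTop 1] with n hn hn1
    have hn0 : (n : ℝ) ≠ 0 := by positivity
    calc p n * (n / c n : ℝ) ^ (r - 1) = (n : ℝ) ^ r * (p n / (c n : ℝ) ^ (r - 1)) * (n : ℝ)⁻¹ := by
          obtain ⟨k, rfl⟩ : ∃ k, r = k + 1 := Nat.exists_eq_succ_of_ne_zero (by omega)
          rw [Nat.add_sub_cancel, div_pow, pow_succ]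
          field_simp
      _ ≤ (2 ^ r * r.factorial * n.choose r) * (p n / (c n : ℝ) ^ (r - 1)) * (n : ℝ)⁻¹ := by
          have := hp n
          gcongr
          exact pow_le_mul_choose hn
      _ = _ := by ring
  -- Smaller exponents follow from the top one: as `p ≤ 1` and `j ≤ r - 1`, the `(r - 1)`-th power
  -- of `p (n / c) ^ j` is at most the `j`-th power of `p (n / c) ^ (r - 1)`.
  refine tendsto_zero_of_tendsto_pow_zero (m := r - 1)
    (fun n ↦ mul_nonneg (hp n) (by positivity)) ?_
  have huj := hu.pow j
  rw [zero_pow (by omega)] at huj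
  refine squeeze_zero (fun n ↦ pow_nonneg (mul_nonneg (hp n) (by positivity)) _) (fun n ↦ ?_) huj
  have hx : 0 ≤ (n / c n : ℝ) := by positivity
  rw [mul_pow, mul_pow, ← pow_mul, ← pow_mul, mul_comm (r - 1)]
  gcongr ?_ * _
  exact pow_le_pow_of_le_one (hp n) (hp1 n) (by omega)

/-! ### The limit theorem -/

theorem corollary1p10 (r : ℕ) (hr : 2 ≤ r)
    -- the parameters of the model and the numbers of colors
    (p ρ : ℕ → ℝ) (c : ℕ → ℕ)
    (hp : ∀ n, 0 < p n ∧ p n < 1)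
    (hρ : ∀ n, 0 ≤ ρ n ∧ ρ n < p n * (1 - p n))
    -- `p ≫ n ^ (-r)`
    (hpn : Tendsto (fun n : ℕ ↦ p n / (n : ℝ) ^ (-(r : ℤ))) atTop atTop)
    -- the scaling assumption
    (lam lam12 : ℝ≥0) (hlam : lam12 < lam)
    (hmean : Tendsto (fun n ↦ (n.choose r : ℝ) * p n / (c n : ℝ) ^ (r - 1)) atTop (𝓝 (lam : ℝ)))
    (hcommon : Tendsto (fun n ↦ (n.choose r : ℝ) * (ρ n + p n ^ 2) / (c n : ℝ) ^ (r - 1)) atTop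
      (𝓝 (lam12 : ℝ)))
    -- the random hypermultiplexes and the random colorings
    {Ω : ℕ → Type*} [∀ n, MeasurableSpace (Ω n)]
    (P : ∀ n, Measure (Ω n)) [∀ n, IsProbabilityMeasure (P n)]
    (H : ∀ n, Ω n → UniformHypergraph (Fin n) r × UniformHypergraph (Fin n) r)
    (hH : ∀ n, IsCorrelatedErdosRenyi (P n) (H n) (p n) (ρ n))
    (X : ∀ n, Ω n → Fin n → Fin (c n))
    (hX : ∀ n, IsUniformColoring (P n) (X n))
    (hHX : ∀ n, IndepFun (H n) (X n) (P n))
    -- the limiting random variables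
    {Ω' : Type*} [MeasurableSpace Ω'] (P' : Measure Ω') [IsProbabilityMeasure P']
    (Z1 Z2 Z12 : Ω' → ℕ)
    (hZ1 : HasLaw Z1 (poissonMeasure (lam - lam12)) P')
    (hZ2 : HasLaw Z2 (poissonMeasure (lam - lam12)) P')
    (hZ12 : HasLaw Z12 (poissonMeasure lam12) P')
    (hZ : iIndepFun ![Z1, Z2, Z12] P') :
    TendstoInDistribution
      (fun n ω ↦ (monoCount (H n ω).1 (X n ω), monoCount (H n ω).2 (X n ω))) atTop
      (fun ω ↦ (Z1 ω + Z12 ω, Z2 ω + Z12 ω)) P P' := by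
  have hmeas (n : ℕ) : Measurable fun ω ↦
      (monoCount (H n ω).1 (X n ω), monoCount (H n ω).2 (X n ω)) :=
    (measurable_of_finite fun y : (UniformHypergraph (Fin n) r × UniformHypergraph (Fin n) r) ×
      (Fin n → Fin (c n)) ↦ (monoCount y.1.1 y.2, monoCount y.1.2 y.2)).comp
      ((hH n).measurable.prodMk (hX n).measurable)
  refine tendstoInDistribution_natPair (fun n ↦ (hmeas n).aemeasurable)
    ((hZ1.aemeasurable.add hZ12.aemeasurable).prodMk (hZ2.aemeasurable.add hZ12.aemeasurable))
    fun s t ↦ ?_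
  set z := Complex.exp (s * Complex.I) with hz
  set w := Complex.exp (t * Complex.I) with hw
  have hz1 : ‖z‖ ≤ 1 := (Complex.norm_exp_ofReal_mul_I s).le
  have hw1 : ‖w‖ ≤ 1 := (Complex.norm_exp_ofReal_mul_I t).le
  have hexp (a b : ℕ) : Complex.exp (((s * a + t * b : ℝ) : ℂ) * Complex.I) = z ^ a * w ^ b := by
    rw [hz, hw, ← Complex.exp_nat_mul, ← Complex.exp_nat_mul, ← Complex.exp_add]
    congr 1
    push_cast
    ring
  rw [integral_exp_bivariate_poisson hZ1 hZ2 hZ12 hZ]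
  simp_rw [hexp]
  let m : ℕ → ℂ := fun n ↦ ((n.choose r * p n / c n ^ (r - 1) : ℝ) : ℂ) * (z - 1)
      + ((n.choose r * p n / c n ^ (r - 1) : ℝ) : ℂ) * (w - 1)
      + ((n.choose r * (ρ n + p n ^ 2) / c n ^ (r - 1) : ℝ) : ℂ) * ((z - 1) * (w - 1))
  have hm : Tendsto m atTop (𝓝 (((lam - lam12 : ℝ≥0) : ℂ) * (z - 1)
      + ((lam - lam12 : ℝ≥0) : ℂ) * (w - 1)
      + (lam12 : ℂ) * (Complex.exp ((s + t : ℝ) * Complex.I) - 1))) := by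
    have hmean' := (Complex.continuous_ofReal.tendsto _).comp hmean
    have hcommon' := (Complex.continuous_ofReal.tendsto _).comp hcommon
    -- The exponents match by `(z - 1) (w - 1) = (z w - 1) - (z - 1) - (w - 1)`, which moves `lam12`
    -- out of both marginal terms.
    convert ((hmean'.mul_const (z - 1)).add (hmean'.mul_const (w - 1))).add
      (hcommon'.mul_const ((z - 1) * (w - 1))) using 2
    · rfl
    have hzw : Complex.exp ((s + t : ℝ) * Complex.I) = z * w := by
      rw [hz, hw, ← Complex.exp_add]
      push_cast
      rw [add_mul]
    -- Subtraction in `ℝ≥0` is truncated; `lam12 ≤ lam` makes it the real one.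
    have hsub : ((lam - lam12 : ℝ≥0) : ℂ) = ((lam : ℝ) : ℂ) - ((lam12 : ℝ) : ℂ) := by
      rw [← Complex.ofReal_sub, ← NNReal.coe_sub hlam.le]
    rw [hzw, hsub]
    have : (lam12 : ℂ) = ((lam12 : ℝ) : ℂ) := rfl
    rw [this]
    ring
  have hzero : ∀ j, 1 ≤ j → j < r → Tendsto (fun n : ℕ ↦ p n * (n / c n : ℝ) ^ j) atTop (𝓝 0) :=
    fun j hj hjr ↦ tendsto_mul_div_pow_zero (fun n ↦ (hp n).1.le) (fun n ↦ (hp n).2.le) hmean hj hjr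
  have herr : Tendsto (fun n : ℕ ↦ Real.exp (2 * ‖m n‖) *
      (64 * (n.choose r * p n / c n ^ (r - 1)) *
        (2 * ∑ k ∈ Finset.Ico 1 r, r.choose k * (p n * (n / c n : ℝ) ^ (r - k)) +
          p n * (n / c n : ℝ) ^ (r - 1)))) atTop (𝓝 0) := by
    have hsum : Tendsto (fun n : ℕ ↦ 2 * ∑ k ∈ Finset.Ico 1 r,
        (r.choose k : ℝ) * (p n * (n / c n : ℝ) ^ (r - k)) + p n * (n / c n : ℝ) ^ (r - 1))
        atTop (𝓝 (2 * ∑ k ∈ Finset.Ico 1 r, (r.choose k : ℝ) * 0 + 0)) := by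
      refine ((tendsto_finsetSum _ fun k hk ↦ ?_).const_mul 2).add
        (hzero (r - 1) (by omega) (by omega))
      have := Finset.mem_Ico.1 hk
      exact (hzero (r - k) (by omega) (by omega)).const_mul _
    have h1 := (Real.continuous_exp.tendsto _).comp (hm.norm.const_mul 2)
    simpa using h1.mul ((hmean.const_mul 64).mul hsum)
  refine (((Complex.continuous_exp.tendsto _).comp hm).congr_dist ?_)
  refine squeeze_zero' (.of_forall fun _ ↦ dist_nonneg) ?_ herr
  filter_upwards [eventually_ne_atTop 0] with n hn
  rw [dist_comm, dist_eq_norm]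
  exact norm_integral_pow_monoCount_sub_exp_le hr hn (hρ n).1 (hρ n).2.le (hH n) (hX n) (hHX n)
    hz1 hw1 rfl
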